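/- **Proposition (Global well-posedness in the continuum model).** Let $k\ge 1$, let $\mathbb S^k\subset\mathbb R^{k+1}$ be the unit sphere with the induced Riemannian metric and geodesic distance $d(x,y)=\arccos(x\cdot y)$, let $N=(0,\dots,0,1)$, fix $\varepsilon\in(0,\pi/2)$, and put $$\mathcal D_\varepsilon=\{x\in\mathbb S^k: d(x,N)<\tfrac{\pi}{2}-\varepsilon\},\qquad \overline D_r=\{x\in\mathbb S^k: d(x,N)\le r\}.$$ Let $K:\mathbb S^k\times\mathbb S^k\to\mathbb R$ be of the form $K(x,y)=g(d(x,y)^2)$, where $g:[0,\infty)\to\mathbb R$ is differentiable with locally Lipschitz derivative $g'\ge 0$. Let $\mathcal P(\mathcal D_\varepsilon)$ be the set of Borel probability measures on $\mathcal D_\varepsilon$ with the narrow topology, and for a curve $(\rho_t)_{t\ge0}$ in $\mathcal P(\mathcal D_\varepsilon)$ let $$v[\rho](x,t)=-\int_{\mathcal D_\varepsilon}\nabla_{\mathbb S^k}K_y(x)\,d\rho_t(y),\qquad K_y(x)=K(x,y),\quad (x,t)\in\mathcal D_\varepsilon\times[0,\infty).$$ The curve is called a *global weak solution* of $\partial_t\rho-\nabla\cdot(\rho\,\nabla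 K*\rho)=0$ if there is exactly one map $\Psi:\operatorname{supp}(\rho_0)\times[0,\infty)\to\mathcal D_\varepsilon$, $(x,t)\mapsto\Psi^t(x)$, such that $\Psi^0(x)=x$ and $\frac{d}{dt}\Psi^t(x)=v[\rho](\Psi^t(x),t)$ for all $x\in\operatorname{supp}(\rho_0)$ and $t\ge0$ (one-sided derivative at $t=0$), and if this map satisfies $\rho_t=\Psi^t\#\rho_0$ (push-forward) for all $t\ge0$. Let $\rho_0\in\mathcal P(\mathcal D_\varepsilon)$ satisfy $\operatorname{supp}(\rho_0)\subset\overline D_r$ for some $r<\pi/2-\varepsilon$. Then there is exactly one global weak solution in $C([0,\infty);\mathcal P(\mathcal D_\varepsilon))$ that starts from $\rho_0$. Moreover, this solution satisfies $\operatorname{supp}(\rho_t)\subset\overline D_r$ for all $t\in[0,\infty)$. -/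

import Mathlib

open MeasureTheory Set
open scoped NNReal RealInnerProductSpace

namespace IntrinsicAggregation

/-- The ambient Euclidean space `ℝ^{k+1}`. -/
abbrev Ambient (k : ℕ) : Type := EuclideanSpace ℝ (Fin (k + 1))

/-- The `k`-dimensional unit sphere in `ℝ^{k+1}`. Its Riemannian metric is the one induced by the
ambient space; points and tangent vectors are regarded as vectors of `ℝ^{k+1}`. -/
abbrev Sph (k : ℕ) : Type := Metric.sphere (0 : Ambient k) 1

/-- The geodesic distance `d(x, y) = arccos (x · y)` on the unit sphere. -/
noncomputable def geoDist {k : ℕ} (x y : Sph k) : ℝ :=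
  Real.arccos ⟪(x : Ambient k), (y : Ambient k)⟫

/-- The North pole `N = (0, …, 0, 1)`. -/
noncomputable def northPole (k : ℕ) : Sph k :=
  ⟨EuclideanSpace.single (Fin.last k) 1, by simp⟩

/-- The open geodesic disk of radius `π/2 - ε` centred at the North pole. -/
def openDisk (k : ℕ) (ε : ℝ) : Set (Sph k) :=
  {x | geoDist x (northPole k) < Real.pi / 2 - ε}

/-- The closed geodesic disk of radius `r` centred at the North pole. -/
def closedDisk (k : ℕ) (r : ℝ) : Set (Sph k) :=
  {x | geoDist x (northPole k) ≤ r}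

/-- Hypothesis (H) on the interaction potential: `K(x, y) = g(d(x, y)²)` with
`g : [0, ∞) → ℝ` differentiable with locally Lipschitz derivative. Only the restriction of `g` to
`[0, ∞)` plays a role; its derivative at `0` is the one-sided one. -/
structure HypothesisH {k : ℕ} (K : Sph k → Sph k → ℝ) (g : ℝ → ℝ) : Prop where
  eq_comp : ∀ x y, K x y = g (geoDist x y ^ 2)
  differentiableOn : DifferentiableOn ℝ g (Ici 0)
  locallyLipschitzOn_deriv : LocallyLipschitzOn (Ici 0) (derivWithin g (Ici 0))

/-- The radial projection `z ↦ z / |z|` of `ℝ^{k+1} ∖ {0}` onto the sphere (its value at the origin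
is irrelevant). -/
noncomputable def radialProj {k : ℕ} (z : Ambient k) : Sph k :=
  if h : z = 0 then northPole k
  else ⟨‖z‖⁻¹ • z, by simp [norm_smul, h]⟩

/-- The Riemannian gradient at `x` of a function `f` on the unit sphere, as a vector of `ℝ^{k+1}`:
the Euclidean gradient at `x` of the extension `z ↦ f (z / |z|)`. This extension is constant along
rays and agrees with `f` on the sphere, so its gradient at `x` is tangent to the sphere and
represents the differential of `f` with respect to the induced metric
(see `sphGradient_orthogonal` and `hasDerivAt_comp_curve`). -/
noncomputable def sphGradient {k : ℕ} (f : Sph k → ℝ) (x : Sph k) : Ambient k :=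
  gradient (fun z : Ambient k => f (radialProj z)) (x : Ambient k)

lemma radialProj_coe {k : ℕ} (x : Sph k) : radialProj (x : Ambient k) = x := by
  have hx : ‖(x : Ambient k)‖ = 1 := by simp
  have h0 : (x : Ambient k) ≠ 0 := by
    intro h
    simp [h] at hx
  apply Subtype.ext
  simp [radialProj, h0]

lemma radialProj_smul {k : ℕ} (x : Sph k) {c : ℝ} (hc : 0 < c) :
    radialProj (c • (x : Ambient k)) = x := by
  have hx : ‖(x : Ambient k)‖ = 1 := by simp
  have h0 : (x : Ambient k) ≠ 0 := by
    intro h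
    simp [h] at hx
  apply Subtype.ext
  simp [radialProj, h0, hc.ne', norm_smul, abs_of_pos hc, smul_smul]

/-- Along a curve on the sphere, a function changes at the rate given by its gradient. -/
lemma hasDerivAt_comp_curve {k : ℕ} {f : Sph k → ℝ} {γ : ℝ → Sph k} {t : ℝ} {w : Ambient k}
    (hf : DifferentiableAt ℝ (fun z : Ambient k => f (radialProj z)) (γ t : Ambient k))
    (hγ : HasDerivAt (fun s => (γ s : Ambient k)) w t) :
    HasDerivAt (fun s => f (γ s)) ⟪sphGradient f (γ t), w⟫ t := by
  have h := hf.hasGradientAt.hasFDerivAt.comp_hasDerivAt t hγ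
  simpa [Function.comp_def, radialProj_coe, sphGradient] using h

/-- The gradient is tangent to the sphere. -/
lemma sphGradient_orthogonal {k : ℕ} {f : Sph k → ℝ} {x : Sph k}
    (hf : DifferentiableAt ℝ (fun z : Ambient k => f (radialProj z)) (x : Ambient k)) :
    ⟪sphGradient f x, (x : Ambient k)⟫ = 0 := by
  have hg : HasDerivAt (fun s : ℝ => s • (x : Ambient k)) (x : Ambient k) 1 := by
    simpa using (hasDerivAt_id (1 : ℝ)).smul_const (x : Ambient k)
  have hf' : HasFDerivAt (fun z : Ambient k => f (radialProj z))
      ((InnerProductSpace.toDual ℝ (Ambient k)) (sphGradient f x)) ((1 : ℝ) • (x : Ambient k)) := by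
    rw [one_smul]
    exact hf.hasGradientAt.hasFDerivAt
  have h := hf'.comp_hasDerivAt (1 : ℝ) hg
  have hc : HasDerivAt (fun s : ℝ => f (radialProj (s • (x : Ambient k)))) 0 1 := by
    refine (hasDerivAt_const (1 : ℝ) (f x)).congr_of_eventuallyEq ?_
    filter_upwards [lt_mem_nhds (zero_lt_one : (0 : ℝ) < 1)] with s hs
    rw [radialProj_smul x hs]
  simpa using h.unique hc

/-- The interaction velocity field
`v[ρ](x, t) = -(∇K ∗ ρ_t)(x) = -∫ ∇K_y(x) dρ_t(y)`, where `K_y(x) = K(x, y)`, of a curve `ρ` of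
probability measures on the open disk. -/
noncomputable def velocity {k : ℕ} {ε : ℝ} (K : Sph k → Sph k → ℝ)
    (ρ : ℝ≥0 → ProbabilityMeasure (openDisk k ε)) (x : openDisk k ε) (t : ℝ≥0) : Ambient k :=
  -∫ y : openDisk k ε, sphGradient (fun z => K z y) x ∂(ρ t : Measure (openDisk k ε))

/-- `Ψ` is a global flow map generated by `(X, Σ)`, where `X` is a time-dependent vector field on
the open disk and `Σ` a subset of it: `d/dt Ψ^t(x) = X_t(Ψ^t(x))` for all `t ≥ 0` (one-sided
derivative at `t = 0`) and `Ψ^0(x) = x`, for all `x ∈ Σ`. -/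
def IsGlobalFlowMap {k : ℕ} {ε : ℝ} (X : openDisk k ε → ℝ≥0 → Ambient k)
    (S : Set (openDisk k ε)) (Ψ : S → ℝ≥0 → openDisk k ε) : Prop :=
  ∀ x : S, Ψ x 0 = x ∧
    ∀ t : ℝ≥0, HasDerivWithinAt (fun s : ℝ => ((Ψ x s.toNNReal : Sph k) : Ambient k))
      (X (Ψ x t) t) (Ici 0) (t : ℝ)

/-- The push-forward `Ψ # μ` of a measure `μ` through a map `Ψ` that is defined on a subset `S`
carrying `μ` only. -/
noncomputable def pushforward {Ω : Type*} [MeasurableSpace Ω] {S : Set Ω} (Ψ : S → Ω)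
    (μ : Measure Ω) : Measure Ω :=
  (μ.comap ((↑) : S → Ω)).map Ψ

/-- Global weak solutions of the aggregation equation `∂ₜρ - ∇·(ρ ∇K ∗ ρ) = 0` on the open disk:
the velocity field `v[ρ]` generates a unique flow map `Ψ` on `supp ρ₀ × [0, ∞)`, and
`ρ_t = Ψ^t # ρ₀` for all `t ≥ 0`. -/
def IsGlobalWeakSolution {k : ℕ} {ε : ℝ} (K : Sph k → Sph k → ℝ)
    (ρ : ℝ≥0 → ProbabilityMeasure (openDisk k ε)) : Prop :=
  ∃ Ψ : (ρ 0 : Measure (openDisk k ε)).support → ℝ≥0 → openDisk k ε,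
    IsGlobalFlowMap (velocity K ρ) _ Ψ ∧
    (∀ Φ : (ρ 0 : Measure (openDisk k ε)).support → ℝ≥0 → openDisk k ε,
      IsGlobalFlowMap (velocity K ρ) _ Φ → Φ = Ψ) ∧
    ∀ t : ℝ≥0, (ρ t : Measure (openDisk k ε)) =
      pushforward (fun x => Ψ x t) (ρ 0 : Measure (openDisk k ε))

end IntrinsicAggregation

namespace IntrinsicAggregation

/-! Write `u = x · y = cos θ`. The chain rule gives `-∇K_y(x) = H(u) (y - u x)` with `H(u) = 2
g'(θ²) θ / sin θ ≥ 0`, so each particle pulls every other one towards itself (`sphGradient_eq`). Any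
two points of the disk are at distance less than `π - 2ε`, hence `u` stays in an interval `[c, 1]`
with `c > -1`, on which `H` is bounded and Lipschitz, including at `u = 1` (`exists_coeff`).

Existence: a weak solution is a particle system labelled by the compact set `supp ρ₀`, that is, an
ODE in the Banach space of continuous maps from `supp ρ₀` to `ℝ^{k+1}`. Composing the kernel with
retractions onto bounded convex sets makes the field globally bounded and Lipschitz, so a global
solution exists. A Grönwall estimate for `1 - |z|²` keeps it on the sphere. Since attraction within
a hemisphere never lowers a particle that is below all the others, a barrier argument keeps it in
the cap `n · z ≥ cos r`. There the retractions act as the identity, so the original system is solved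
(`exists_flow`).

Uniqueness: two solutions push the same measure forward from the same labels, and the difference of
their velocities is at most a constant times the largest difference of the flows over all labels. A
Grönwall argument uniform in the labels concludes (`eq_of_deriv_sub_le`). -/

/-! ### Calculus of `arccos² u` and `θ / sin θ` up to `u = 1` -/

/-- The ratio `θ / sin θ` for `θ = arccos u`, extended by continuity to `u = 1`. -/
noncomputable def angleRatio (u : ℝ) : ℝ := (Real.sinc (Real.arccos u))⁻¹

lemma sinc_pos {θ : ℝ} (h0 : 0 ≤ θ) (h1 : θ < Real.pi) : 0 < Real.sinc θ := by
  rcases h0.eq_or_lt with rfl | h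
  · simp
  · rw [Real.sinc_of_ne_zero h.ne']
    exact div_pos (Real.sin_pos_of_pos_of_lt_pi h h1) h

lemma arccos_lt_pi {u : ℝ} (h : -1 < u) : Real.arccos u < Real.pi :=
  lt_of_le_of_ne (Real.arccos_le_pi u) fun h' => absurd (Real.arccos_eq_pi.1 h') (not_le.2 h)

lemma sinc_arccos_pos {u : ℝ} (h : -1 < u) : 0 < Real.sinc (Real.arccos u) :=
  sinc_pos (Real.arccos_nonneg u) (arccos_lt_pi h)

lemma angleRatio_pos {u : ℝ} (h : -1 < u) : 0 < angleRatio u :=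
  inv_pos.2 (sinc_arccos_pos h)

lemma exists_le_sinc_arccos {c : ℝ} (hc : -1 < c) :
    ∃ m > 0, ∀ u ∈ Icc c 1, m ≤ Real.sinc (Real.arccos u) := by
  rcases (Icc c 1).eq_empty_or_nonempty with he | hne
  · exact ⟨1, one_pos, by simp [he]⟩
  obtain ⟨v, hv, hmin⟩ := isCompact_Icc.exists_isMinOn hne
    (Real.continuous_sinc.comp Real.continuous_arccos).continuousOn
  exact ⟨_, sinc_arccos_pos (hc.trans_le hv.1), fun u hu => hmin hu⟩

lemma continuousAt_angleRatio {u : ℝ} (h : -1 < u) : ContinuousAt angleRatio u :=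
  ((Real.continuous_sinc.comp Real.continuous_arccos).continuousAt).inv₀ (sinc_arccos_pos h).ne'

lemma angleRatio_eq {u : ℝ} (h1 : u < 1) :
    angleRatio u = Real.arccos u / Real.sin (Real.arccos u) := by
  rw [angleRatio, Real.sinc_of_ne_zero (Real.arccos_pos.2 h1).ne', inv_div]

lemma sin_arccos_pos {u : ℝ} (h0 : -1 < u) (h1 : u < 1) : 0 < Real.sin (Real.arccos u) :=
  Real.sin_pos_of_pos_of_lt_pi (Real.arccos_pos.2 h1) (arccos_lt_pi h0)

lemma hasDerivAt_arccos_sin {u : ℝ} (h0 : -1 < u) (h1 : u < 1) :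
    HasDerivAt Real.arccos (-(Real.sin (Real.arccos u))⁻¹) u := by
  simpa [Real.sin_arccos] using Real.hasDerivAt_arccos h0.ne' h1.ne

lemma hasDerivAt_arccos_sq {u : ℝ} (h0 : -1 < u) (h1 : u < 1) :
    HasDerivAt (fun u => Real.arccos u ^ 2) (-(2 * angleRatio u)) u := by
  refine ((hasDerivAt_arccos_sin h0 h1).pow 2).congr_deriv ?_
  rw [angleRatio_eq h1]
  simp
  ring

/-- Although `arccos` is not differentiable at `1`, the derivative of its square has a limit there,
which is then the left derivative. A left derivative suffices because inner products of unit vectors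
never exceed `1`; it is all that is available, as `arccos` is constant beyond `1`. -/
lemma hasDerivWithinAt_arccos_sq {u : ℝ} (h0 : -1 < u) (h1 : u ≤ 1) :
    HasDerivWithinAt (fun u => Real.arccos u ^ 2) (-(2 * angleRatio u)) (Iic 1) u := by
  rcases h1.eq_or_lt with rfl | h1
  · refine hasDerivWithinAt_Iic_of_tendsto_deriv (s := Ioo (-1) 1)
      (fun v hv => (hasDerivAt_arccos_sq hv.1 hv.2).differentiableAt.differentiableWithinAt)
      (Real.continuous_arccos.pow 2).continuousWithinAt
      (Ioo_mem_nhdsLT (by norm_num)) ?_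
    have h : Filter.Tendsto (fun u => -(2 * angleRatio u)) (nhdsWithin 1 (Iio 1))
        (nhds (-(2 * angleRatio 1))) :=
      (((continuousAt_angleRatio h0).const_mul 2).neg).continuousWithinAt
    refine h.congr' ?_
    filter_upwards [Ioo_mem_nhdsLT (show (-1 : ℝ) < 1 by norm_num)] with v hv
    exact (hasDerivAt_arccos_sq hv.1 hv.2).deriv.symm
  · exact (hasDerivAt_arccos_sq h0 h1).hasDerivWithinAt

lemma hasDerivAt_angleRatio {u : ℝ} (h0 : -1 < u) (h1 : u < 1) :
    HasDerivAt angleRatio ((Real.arccos u * Real.cos (Real.arccos u) - Real.sin (Real.arccos u)) /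
      Real.sin (Real.arccos u) ^ 3) u := by
  have hs := sin_arccos_pos h0 h1
  have hd := hasDerivAt_arccos_sin h0 h1
  have h := hd.div ((Real.hasDerivAt_sin _).comp u hd) hs.ne'
  have h' : HasDerivAt (fun v => Real.arccos v / Real.sin (Real.arccos v))
      ((Real.arccos u * Real.cos (Real.arccos u) - Real.sin (Real.arccos u)) /
      Real.sin (Real.arccos u) ^ 3) u := by
    refine h.congr_deriv ?_
    simp only [Function.comp_apply]
    field_simp
    ring
  refine h'.congr_of_eventuallyEq ?_
  filter_upwards [gt_mem_nhds h1] with v hv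
  exact angleRatio_eq hv

lemma mul_cos_le_sin {θ : ℝ} (h0 : 0 ≤ θ) (h1 : θ ≤ Real.pi) :
    θ * Real.cos θ ≤ Real.sin θ := by
  rcases h0.eq_or_lt with rfl | h0
  · simp
  rcases lt_or_ge θ (Real.pi / 2) with h | h
  · have hc := Real.cos_pos_of_mem_Ioo ⟨by linarith, h⟩
    have := Real.lt_tan h0 h
    rw [Real.tan_eq_sin_div_cos, lt_div_iff₀ hc] at this
    exact this.le
  · have hc := Real.cos_nonpos_of_pi_div_two_le_of_le h (by linarith)
    have := Real.sin_nonneg_of_nonneg_of_le_pi h0.le h1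
    nlinarith

/-- A bound on the derivative away from the right end point gives a Lipschitz bound up to it. -/
lemma abs_sub_le_of_hasDerivAt {f f' : ℝ → ℝ} {c d C : ℝ} (hf : ContinuousOn f (Icc c d))
    (hd : ∀ u ∈ Ico c d, HasDerivAt f (f' u) u) (hb : ∀ u ∈ Ico c d, |f' u| ≤ C) :
    ∀ u ∈ Icc c d, ∀ v ∈ Icc c d, |f u - f v| ≤ C * |u - v| := by
  have key : ∀ u ∈ Icc c d, ∀ v ∈ Icc c d, u ≤ v → |f v - f u| ≤ C * |v - u| := by
    intro u hu v hv huv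
    have hsub : Ico u v ⊆ Ico c d := Ico_subset_Ico hu.1 hv.2
    have := norm_image_sub_le_of_norm_deriv_right_le_segment (f := f) (f' := f') (a := u) (b := v)
      (hf.mono (Icc_subset_Icc hu.1 hv.2)) (fun x hx => (hd x (hsub hx)).hasDerivWithinAt)
      (C := C) (fun x hx => hb x (hsub hx)) v (right_mem_Icc.2 huv)
    rwa [abs_of_nonneg (sub_nonneg.2 huv)]
  intro u hu v hv
  rcases le_total u v with h | h
  · rw [abs_sub_comm, abs_sub_comm u]; exact key u hu v hv h
  · exact key v hv u hu h

lemma exists_lipschitz_arccos_sq {c : ℝ} (hc : -1 < c) :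
    ∃ C, ∀ u ∈ Icc c 1, ∀ v ∈ Icc c 1,
      |Real.arccos u ^ 2 - Real.arccos v ^ 2| ≤ C * |u - v| := by
  obtain ⟨m, hm, hmle⟩ := exists_le_sinc_arccos hc
  refine ⟨2 * m⁻¹, abs_sub_le_of_hasDerivAt (Real.continuous_arccos.pow 2).continuousOn
    (fun u hu => hasDerivAt_arccos_sq (hc.trans_le hu.1) hu.2) fun u hu => ?_⟩
  have h0 := angleRatio_pos (hc.trans_le hu.1)
  rw [abs_neg, abs_of_pos (by positivity)]
  gcongr
  exact inv_anti₀ hm (hmle u ⟨hu.1, hu.2.le⟩)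

/-- The derivative is `(θ cos θ - sin θ) / sin³ θ`. From `sin θ ≤ θ` and `cos θ ≥ 1 - θ²/2` the
numerator is at most `θ³/2` in absolute value, and `sin θ ≥ m θ` on the range considered, so the
singularity at `θ = 0` cancels. -/
lemma exists_lipschitz_angleRatio {c : ℝ} (hc : -1 < c) :
    ∃ C, ∀ u ∈ Icc c 1, ∀ v ∈ Icc c 1, |angleRatio u - angleRatio v| ≤ C * |u - v| := by
  obtain ⟨m, hm, hmle⟩ := exists_le_sinc_arccos hc
  refine ⟨(2 * m ^ 3)⁻¹, abs_sub_le_of_hasDerivAt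
    (fun u hu => (continuousAt_angleRatio (hc.trans_le hu.1)).continuousWithinAt)
    (fun u hu => hasDerivAt_angleRatio (hc.trans_le hu.1) hu.2) fun u hu => ?_⟩
  have hs := sin_arccos_pos (hc.trans_le hu.1) hu.2
  have hθ := Real.arccos_pos.2 hu.2
  have hmθ : m * Real.arccos u ≤ Real.sin (Real.arccos u) := by
    have := hmle u ⟨hu.1, hu.2.le⟩
    rwa [Real.sinc_of_ne_zero hθ.ne', le_div_iff₀ hθ] at this
  have h1 := mul_cos_le_sin hθ.le (Real.arccos_le_pi u)
  have h2 := Real.sin_le hθ.le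
  have h3 := Real.one_sub_sq_div_two_le_cos (x := Real.arccos u)
  generalize Real.arccos u = θ at *
  have h4 : (m * θ) ^ 3 ≤ Real.sin θ ^ 3 := by gcongr
  rw [abs_div, abs_of_pos (by positivity : 0 < Real.sin θ ^ 3), abs_of_nonpos (by linarith),
    div_le_iff₀ (by positivity), inv_mul_eq_div, le_div_iff₀ (by positivity)]
  have h5 : -(θ * Real.cos θ - Real.sin θ) ≤ θ ^ 3 / 2 := by nlinarith
  calc _ ≤ θ ^ 3 / 2 * (2 * m ^ 3) := by gcongr
    _ = (m * θ) ^ 3 := by ring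
    _ ≤ _ := h4

/-! ### The interaction strength `H` and the gradient of the potential -/

lemma exists_coeff {k : ℕ} {K : Sph k → Sph k → ℝ} {g : ℝ → ℝ} (hK : HypothesisH K g)
    (hg : ∀ s : ℝ, 0 ≤ s → 0 ≤ derivWithin g (Ici 0) s) {c : ℝ} (hc : -1 < c) (hc1 : c ≤ 1) :
    ∃ (H : ℝ → ℝ) (B L : ℝ), 0 ≤ B ∧ 0 ≤ L ∧ (∀ u, 0 ≤ H u) ∧ (∀ u, |H u| ≤ B) ∧
      (∀ u v, |H u - H v| ≤ L * |u - v|) ∧ ∀ u ∈ Icc c 1,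
        H u = derivWithin g (Ici 0) (Real.arccos u ^ 2) * (2 * angleRatio u) := by
  obtain ⟨C₁, h₁⟩ := exists_lipschitz_arccos_sq hc
  obtain ⟨C₂, h₂⟩ := exists_lipschitz_angleRatio hc
  obtain ⟨C₀, h₀⟩ := (hK.locallyLipschitzOn_deriv.mono
    (Icc_subset_Ici_self (a := Real.pi ^ 2) (b := (0 : ℝ)))).exists_lipschitzOnWith_of_compact
    isCompact_Icc
  have hmem : ∀ u : ℝ, Real.arccos u ^ 2 ∈ Icc (0 : ℝ) (Real.pi ^ 2) := fun u =>
    ⟨by positivity, by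
      have := Real.arccos_nonneg u
      have := Real.arccos_le_pi u
      gcongr⟩
  set a : ℝ → ℝ := fun u => derivWithin g (Ici 0) (Real.arccos u ^ 2) with ha
  have ha_nonneg : ∀ u, 0 ≤ a u := fun u => hg _ (by positivity)
  have ha_cont : Continuous a := by
    have hco := h₀.continuousOn
    exact hco.comp_continuous (Real.continuous_arccos.pow 2) hmem
  have ha_lip : ∀ u ∈ Icc c 1, ∀ v ∈ Icc c 1, |a u - a v| ≤ C₀ * C₁ * |u - v| := by
    intro u hu v hv
    have h := h₀.dist_le_mul _ (hmem u) _ (hmem v)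
    rw [Real.dist_eq, Real.dist_eq] at h
    calc |a u - a v| ≤ C₀ * |Real.arccos u ^ 2 - Real.arccos v ^ 2| := h
      _ ≤ C₀ * (C₁ * |u - v|) := by gcongr; exact h₁ u hu v hv
      _ = _ := by ring
  have hr_cont : ContinuousOn angleRatio (Icc c 1) := fun u hu =>
    (continuousAt_angleRatio (hc.trans_le hu.1)).continuousWithinAt
  obtain ⟨A, hA⟩ := isCompact_Icc.exists_bound_of_continuousOn (ha_cont.continuousOn (s := Icc c 1))
  obtain ⟨R, hR⟩ := isCompact_Icc.exists_bound_of_continuousOn hr_cont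
  simp only [Real.norm_eq_abs] at hA hR
  have h1mem : (1 : ℝ) ∈ Icc c 1 := ⟨hc1, le_rfl⟩
  have hA0 : 0 ≤ A := (abs_nonneg _).trans (hA 1 h1mem)
  have hR0 : 0 ≤ R := (abs_nonneg _).trans (hR 1 h1mem)
  -- Clamping the argument to `[c, 1]` extends the coefficient to all of `ℝ` without losing its
  -- sign, bound or Lipschitz constant.
  let p : ℝ → ℝ := fun u => projIcc c 1 hc1 u
  have hp : ∀ u, p u ∈ Icc c 1 := fun u => (projIcc c 1 hc1 u).2
  have hplip : ∀ u v, |p u - p v| ≤ |u - v| := fun u v => by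
    have := (LipschitzWith.projIcc hc1).dist_le_mul u v
    simpa [Subtype.dist_eq, Real.dist_eq] using this
  refine ⟨fun u => a (p u) * (2 * angleRatio (p u)), A * (2 * R),
    |A * (2 * C₂) + C₀ * C₁ * (2 * R)|, by positivity, abs_nonneg _, fun u => ?_, fun u => ?_,
    fun u v => ?_, fun u hu => ?_⟩
  · exact mul_nonneg (ha_nonneg _)
      (mul_nonneg two_pos.le (angleRatio_pos (hc.trans_le (hp u).1)).le)
  · rw [abs_mul, abs_mul, abs_two]
    gcongr
    · exact hA _ (hp u)
    · exact hR _ (hp u)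
  · have e : a (p u) * (2 * angleRatio (p u)) - a (p v) * (2 * angleRatio (p v)) =
        a (p u) * (2 * (angleRatio (p u) - angleRatio (p v))) +
          (a (p u) - a (p v)) * (2 * angleRatio (p v)) := by ring
    rw [e]
    calc _ ≤ |a (p u)| * (2 * |angleRatio (p u) - angleRatio (p v)|) +
          |a (p u) - a (p v)| * (2 * |angleRatio (p v)|) := by
          refine (abs_add_le _ _).trans_eq ?_
          simp only [abs_mul, abs_two]
      _ ≤ A * (2 * (C₂ * |p u - p v|)) + C₀ * C₁ * |p u - p v| * (2 * R) := by
          gcongr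
          · exact hA _ (hp u)
          · exact h₂ _ (hp u) _ (hp v)
          · exact (abs_nonneg _).trans (ha_lip _ (hp u) _ (hp v))
          · exact ha_lip _ (hp u) _ (hp v)
          · exact hR _ (hp v)
      _ = (A * (2 * C₂) + C₀ * C₁ * (2 * R)) * |p u - p v| := by ring
      _ ≤ |A * (2 * C₂) + C₀ * C₁ * (2 * R)| * |p u - p v| := by
          gcongr; exact le_abs_self _
      _ ≤ _ := mul_le_mul_of_nonneg_left (hplip u v) (abs_nonneg _)
  · have : p u = u := by simp [p, projIcc_of_mem hc1 hu]
    simp only [this, ha]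

lemma inner_le_one {k : ℕ} (x y : Sph k) : ⟪(x : Ambient k), (y : Ambient k)⟫ ≤ 1 := by
  simpa using real_inner_le_norm (x : Ambient k) (y : Ambient k)

/-- Near `x` the function is `(|z|²)^(-1/2) (y · z)`; the product rule at `|x| = 1` produces the
tangential part of `y`. -/
lemma hasFDerivAt_inner_radialProj {k : ℕ} (x y : Sph k) :
    HasFDerivAt (fun z : Ambient k => ⟪(radialProj z : Ambient k), (y : Ambient k)⟫)
      (innerSL ℝ ((y : Ambient k) - ⟪(x : Ambient k), (y : Ambient k)⟫ • (x : Ambient k)))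
      (x : Ambient k) := by
  have hx : ‖(x : Ambient k)‖ = 1 := by simp
  have h1 : HasDerivAt (fun t : ℝ => (√t)⁻¹) (-(1 / 2)) (‖(x : Ambient k)‖ ^ 2) := by
    rw [hx]
    refine ((Real.hasDerivAt_sqrt (by norm_num : (1 : ℝ) ^ 2 ≠ 0)).inv (by simp)).congr_deriv ?_
    norm_num
  have h2 := h1.comp_hasFDerivAt (x : Ambient k) (hasStrictFDerivAt_norm_sq _).hasFDerivAt
  have h3 : HasFDerivAt (fun z : Ambient k => ⟪(y : Ambient k), z⟫) (innerSL ℝ (y : Ambient k))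
    (x : Ambient k) := (innerSL ℝ (y : Ambient k)).hasFDerivAt
  have h4 := h2.mul h3
  refine (h4.congr_fderiv ?_).congr_of_eventuallyEq ?_
  · ext w
    simp [real_inner_comm]
    ring
  · have h0 : (x : Ambient k) ≠ 0 := by intro h; simp [h] at hx
    filter_upwards [isOpen_ne.mem_nhds h0] with z hz
    simp only [radialProj, dif_neg hz, Function.comp_apply, Pi.mul_apply]
    rw [Real.sqrt_sq (norm_nonneg _), inner_smul_left, real_inner_comm]
    simp

/-- Both `g` and `arccos²` may have only one-sided derivatives, at `0` and `1` respectively. The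
inner functions take values in `[0, ∞)` and `(-∞, 1]`, so the composition still has a full
derivative, even at `x = y`. -/
lemma sphGradient_eq {k : ℕ} {K : Sph k → Sph k → ℝ} {g : ℝ → ℝ} (hK : HypothesisH K g)
    {x y : Sph k} (hxy : -1 < ⟪(x : Ambient k), (y : Ambient k)⟫) :
    sphGradient (fun z => K z y) x =
      -((derivWithin g (Ici 0) (Real.arccos ⟪(x : Ambient k), (y : Ambient k)⟫ ^ 2) *
        (2 * angleRatio ⟪(x : Ambient k), (y : Ambient k)⟫)) •
        ((y : Ambient k) - ⟪(x : Ambient k), (y : Ambient k)⟫ • (x : Ambient k))) := by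
  set u := ⟪(x : Ambient k), (y : Ambient k)⟫ with hu
  have hg : HasDerivWithinAt g (derivWithin g (Ici 0) (Real.arccos u ^ 2)) (Ici 0)
      (Real.arccos u ^ 2) :=
    (hK.differentiableOn _ (by simp only [mem_Ici]; positivity)).hasDerivWithinAt
  have h1 := hg.comp u (hasDerivWithinAt_arccos_sq hxy (inner_le_one x y))
    (fun v _ => by simp only [mem_Ici]; positivity)
  have h2 := (hasFDerivAt_inner_radialProj x y).hasFDerivWithinAt (s := univ)
  have hux : ⟪(radialProj (x : Ambient k) : Ambient k), (y : Ambient k)⟫ = u := by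
    rw [radialProj_coe]
  rw [← hux] at h1
  have h3 := h1.comp_hasFDerivWithinAt (x : Ambient k) h2
    (fun z _ => inner_le_one (radialProj z) y)
  rw [hasFDerivWithinAt_univ, hux] at h3
  have h4 : HasGradientAt (fun z : Ambient k => K (radialProj z) y)
      (-((derivWithin g (Ici 0) (Real.arccos u ^ 2) * (2 * angleRatio u)) •
        ((y : Ambient k) - u • (x : Ambient k)))) (x : Ambient k) := by
    rw [hasGradientAt_iff_hasFDerivAt]
    have e : (fun z : Ambient k => K (radialProj z) y) =
        (g ∘ fun u => Real.arccos u ^ 2) ∘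
          fun z : Ambient k => ⟪(radialProj z : Ambient k), (y : Ambient k)⟫ := by
      ext z
      simp [hK.eq_comp, geoDist]
    rw [e]
    refine h3.congr_fderiv ?_
    ext w
    simp [← hu]
  exact h4.gradient

/-! ### Uniqueness and global existence for ordinary differential equations -/

/-- Two families of bounded curves that start at the same points coincide if the difference of
their derivatives is controlled by the difference of the curves. -/
lemma eq_of_deriv_sub_le {ι E : Type*} [NormedAddCommGroup E] [NormedSpace ℝ E]
    {u v u' v' : ι → ℝ → E} {L M : ℝ} (hL : 0 < L)
    (hu : ∀ i, ∀ t, 0 ≤ t → HasDerivWithinAt (u i) (u' i t) (Ici 0) t)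
    (hv : ∀ i, ∀ t, 0 ≤ t → HasDerivWithinAt (v i) (v' i t) (Ici 0) t)
    (h0 : ∀ i, u i 0 = v i 0) (hM : ∀ i, ∀ t, 0 ≤ t → ‖u i t - v i t‖ ≤ M)
    (h : ∀ t, 0 ≤ t → ∀ S, (∀ j, ‖u j t - v j t‖ ≤ S) → ∀ i, ‖u' i t - v' i t‖ ≤ L * S) :
    ∀ i, ∀ t, 0 ≤ t → u i t = v i t := by
  -- If all differences are at most `M' exp(2Lt)`, their derivatives are at most `L M' exp(2Lt)`,
  -- the derivative of `(M'/2) exp(2Lt)`. So the bound halves, and iterating forces zero. Continuity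
  -- in time of the supremum over `i` is never needed.
  have step : ∀ M', (∀ i, ∀ t, 0 ≤ t → ‖u i t - v i t‖ ≤ M' * Real.exp (2 * L * t)) →
      ∀ i, ∀ t, 0 ≤ t → ‖u i t - v i t‖ ≤ M' / 2 * Real.exp (2 * L * t) := by
    intro M' hM' i t ht
    have hM0 : 0 ≤ M' := by simpa [h0 i] using hM' i 0 le_rfl
    have hd : ∀ s, 0 ≤ s → HasDerivWithinAt (fun s => u i s - v i s) (u' i s - v' i s) (Ici 0) s :=
      fun s hs => (hu i s hs).sub (hv i s hs)
    refine image_norm_le_of_norm_deriv_right_le_deriv_boundary (a := 0) (b := t)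
      (B := fun t => M' / 2 * Real.exp (2 * L * t))
      (B' := fun t => M' / 2 * (Real.exp (2 * L * t) * (2 * L)))
      (fun s hs => (hd s hs.1).continuousWithinAt.mono Icc_subset_Ici_self)
      (fun s hs => (hd s hs.1).mono (Ici_subset_Ici.2 hs.1)) (by simp [h0 i]; positivity)
      (fun s => ?_) (fun s hs => ?_) (right_mem_Icc.2 ht)
    · have h1 : HasDerivAt (fun t : ℝ => 2 * L * t) (2 * L) s := by
        simpa using (hasDerivAt_id s).const_mul (2 * L)
      exact h1.exp.const_mul _
    · refine (h s hs.1 _ (fun j => hM' j s hs.1) i).trans_eq ?_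
      ring
  have hn : ∀ n : ℕ, ∀ i, ∀ t, 0 ≤ t →
      ‖u i t - v i t‖ ≤ M * (1 / 2) ^ n * Real.exp (2 * L * t) := by
    intro n
    induction n with
    | zero =>
      intro i t ht
      have h1 := hM i t ht
      have h2 : 1 ≤ Real.exp (2 * L * t) := Real.one_le_exp (by positivity)
      have h3 := (norm_nonneg _).trans h1
      simp only [pow_zero, mul_one]
      nlinarith
    | succ n ih =>
      intro i t ht
      refine (step _ ih i t ht).trans_eq ?_
      rw [pow_succ]
      ring
  intro i t ht
  have hlim : Filter.Tendsto (fun n : ℕ => M * (1 / 2 : ℝ) ^ n * Real.exp (2 * L * t))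
      Filter.atTop (nhds (M * 0 * Real.exp (2 * L * t))) :=
    ((tendsto_pow_atTop_nhds_zero_of_lt_one (by norm_num) (by norm_num)).const_mul M).mul_const _
  have := ge_of_tendsto' hlim (fun n => hn n i t ht)
  rw [mul_zero, zero_mul, norm_le_zero_iff, sub_eq_zero] at this
  exact this

/-- A bounded, globally Lipschitz vector field on a Banach space has global integral curves. -/
lemma exists_global_solution {X : Type*} [NormedAddCommGroup X] [NormedSpace ℝ X] [CompleteSpace X]
    {V : X → X} {L : ℝ≥0} {B : ℝ} (hV : LipschitzWith L V) (hB : ∀ x, ‖V x‖ ≤ B) (x₀ : X) :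
    ∃ α : ℝ → X, α 0 = x₀ ∧ ∀ t, 0 ≤ t → HasDerivWithinAt α (V (α t)) (Ici 0) t := by
  have hB0 : 0 ≤ B := (norm_nonneg _).trans (hB x₀)
  have hloc : ∀ n : ℕ, ∃ α : ℝ → X, α 0 = x₀ ∧
      ∀ t ∈ Icc (0 : ℝ) (n + 1), HasDerivWithinAt α (V (α t)) (Icc 0 (n + 1)) t := by
    intro n
    have hn : (0 : ℝ) ≤ n + 1 := by positivity
    -- With speed at most `B`, a curve cannot leave the ball of radius `B (n + 1)` during a time `n
    -- + 1`, so the whole interval is reached at once.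
    have hpl : IsPicardLindelof (fun _ => V) (⟨0, left_mem_Icc.2 hn⟩ : Icc (0 : ℝ) (n + 1)) x₀
        (B.toNNReal * (n + 1)) 0 B.toNNReal L :=
      { lipschitzOnWith := fun _ _ => hV.lipschitzOnWith
        continuousOn := fun _ _ => continuousOn_const
        norm_le := fun _ _ x _ => by rw [Real.coe_toNNReal _ hB0]; exact hB x
        mul_max_le := by simp [hn] }
    exact hpl.exists_eq_forall_mem_Icc_hasDerivWithinAt₀
  choose α hα0 hα using hloc
  have hIci : ∀ n : ℕ, ∀ t ∈ Ico (0 : ℝ) (n + 1), HasDerivWithinAt (α n) (V (α n t)) (Ici 0) t := by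
    intro n t ht
    refine (hα n t ⟨ht.1, ht.2.le⟩).mono_of_mem_nhdsWithin ?_
    rw [← Ici_inter_Iic]
    exact Filter.inter_mem self_mem_nhdsWithin (mem_nhdsWithin_of_mem_nhds (Iic_mem_nhds ht.2))
  have huniq : ∀ m n : ℕ, m ≤ n → EqOn (α m) (α n) (Icc 0 (m + 1)) := by
    intro m n hmn
    have hmn' : (m : ℝ) ≤ n := by exact_mod_cast hmn
    refine ODE_solution_unique_of_mem_Icc_right (v := fun _ => V) (s := fun _ => univ)
      (fun _ _ => hV.lipschitzOnWith)
      (fun t ht => (hα m t ht).continuousWithinAt)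
      (fun t ht => (hIci m t ht).mono (Ici_subset_Ici.2 ht.1)) (fun _ _ => mem_univ _)
      (fun t ht => ((hα n t ⟨ht.1, ht.2.trans (by linarith)⟩).continuousWithinAt).mono
        (Icc_subset_Icc_right (by linarith)))
      (fun t ht => (hIci n t ⟨ht.1, ht.2.trans_le (by linarith)⟩).mono (Ici_subset_Ici.2 ht.1))
      (fun _ _ => mem_univ _) (by rw [hα0, hα0])
  have heq : ∀ n : ℕ, ∀ t ∈ Ico (0 : ℝ) (n + 1), α ⌊t⌋₊ t = α n t := by
    intro n t ht
    refine huniq _ _ ?_ ⟨ht.1, (Nat.lt_floor_add_one t).le⟩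
    have := (Nat.floor_lt ht.1 (n := n + 1)).2 (by exact_mod_cast ht.2)
    omega
  -- Solution number `n` lives on `[0, n + 1]`, so `t` is strictly below the end of the interval of
  -- solution number `⌊t⌋`, and near `t` the glued curve is that solution.
  refine ⟨fun t => α ⌊t⌋₊ t, by simp [hα0], fun t ht => ?_⟩
  have hmem : t ∈ Ico (0 : ℝ) ((⌊t⌋₊ : ℝ) + 1) := ⟨ht, Nat.lt_floor_add_one t⟩
  refine (hIci ⌊t⌋₊ t hmem).congr_of_eventuallyEq ?_ rfl
  filter_upwards [self_mem_nhdsWithin, mem_nhdsWithin_of_mem_nhds (Iio_mem_nhds hmem.2)] with s h1 h2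
  exact heq _ s ⟨h1, h2⟩

/-! ### Lipschitz retractions onto convex sets -/

section Projection

variable {E : Type*} [NormedAddCommGroup E] [InnerProductSpace ℝ E]

/-- The metric projection onto a nonempty complete convex set. -/
lemma exists_lipschitz_projection {C : Set E} (hne : C.Nonempty) (hc : IsComplete C)
    (hconv : Convex ℝ C) :
    ∃ P : E → E, (∀ x, P x ∈ C) ∧ (∀ x ∈ C, P x = x) ∧ ∀ x y, ‖P x - P y‖ ≤ ‖x - y‖ := by
  choose P hP hmin using exists_norm_eq_iInf_of_complete_convex hne hc hconv
  have hchar : ∀ x, ∀ w ∈ C, ⟪x - P x, w - P x⟫ ≤ 0 := fun x =>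
    (norm_eq_iInf_iff_real_inner_le_zero hconv (hP x)).1 (hmin x)
  refine ⟨P, hP, fun x hx => ?_, fun x y => ?_⟩
  · have := hchar x x hx
    rw [real_inner_self_nonpos, sub_eq_zero] at this
    exact this.symm
  · have h1 := hchar x (P y) (hP y)
    have h2 := hchar y (P x) (hP x)
    -- The sum of the variational inequalities at `x` and at `y`.
    have h3 : ‖P x - P y‖ * ‖P x - P y‖ ≤ ⟪x - y, P x - P y⟫ := by
      rw [← real_inner_self_eq_norm_mul_norm]
      have e : ⟪x - y, P x - P y⟫ - ⟪P x - P y, P x - P y⟫ =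
          -⟪x - P x, P y - P x⟫ - ⟪y - P y, P x - P y⟫ := by
        rw [← neg_sub (P x) (P y), inner_neg_right, neg_neg, ← inner_sub_left, ← inner_sub_left]
        congr 1
        abel
      linarith
    have h4 := real_inner_le_norm (x - y) (P x - P y)
    rcases (norm_nonneg (P x - P y)).eq_or_lt with h | h
    · rw [← h]; exact norm_nonneg _
    · exact le_of_mul_le_mul_right (h3.trans h4) h

/-- The radial projection onto the closed unit ball. -/
noncomputable def ballProj (x : E) : E := (max 1 ‖x‖)⁻¹ • x

lemma ballProj_of_norm_le {x : E} (hx : ‖x‖ ≤ 1) : ballProj x = x := by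
  simp [ballProj, max_eq_left hx]

lemma norm_ballProj_le (x : E) : ‖ballProj x‖ ≤ 1 := by
  rw [ballProj, norm_smul, norm_inv, Real.norm_of_nonneg (by positivity), inv_mul_le_iff₀
    (by positivity), mul_one]
  exact le_max_right _ _

lemma norm_ballProj_sub_le (x y : E) : ‖ballProj x - ballProj y‖ ≤ 2 * ‖x - y‖ := by
  set a := max 1 ‖x‖
  set b := max 1 ‖y‖
  have ha : 1 ≤ a := le_max_left _ _
  have hb : 1 ≤ b := le_max_left _ _
  have hyb : ‖y‖ ≤ b := le_max_right _ _
  have hab : |b - a| ≤ ‖x - y‖ := by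
    have h1 := abs_max_sub_max_le_max 1 ‖y‖ 1 ‖x‖
    have h2 := abs_norm_sub_norm_le y x
    rw [norm_sub_rev] at h2
    simpa using h1.trans (max_le (by simp) h2)
  have e : ballProj x - ballProj y = a⁻¹ • (x - y) + (a⁻¹ * (b - a) * b⁻¹) • y := by
    have : a⁻¹ * (b - a) * b⁻¹ = a⁻¹ - b⁻¹ := by field_simp
    rw [this, smul_sub, sub_smul]
    change a⁻¹ • x - b⁻¹ • y = _
    abel
  have ha' : |a⁻¹| ≤ 1 := by
    rw [abs_of_pos (by positivity)]; exact inv_le_one_of_one_le₀ ha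
  have hby : |b⁻¹| * ‖y‖ ≤ 1 := by
    rw [abs_of_pos (by positivity), inv_mul_le_iff₀ (by positivity), mul_one]; exact hyb
  rw [e]
  calc _ ≤ |a⁻¹| * ‖x - y‖ + |a⁻¹| * |b - a| * (|b⁻¹| * ‖y‖) := by
        refine (norm_add_le _ _).trans_eq ?_
        simp only [norm_smul, Real.norm_eq_abs, abs_mul]
        ring
    _ ≤ 1 * ‖x - y‖ + 1 * ‖x - y‖ * 1 := by gcongr
    _ = _ := by ring

end Projection

/-! ### The attraction kernel: bounds and signs -/

section Field

variable {E : Type*} [NormedAddCommGroup E] [InnerProductSpace ℝ E]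

/-- The attraction exerted at `x` by a particle at `y`, with strength `H (x · y)`. -/
noncomputable def attraction (H : ℝ → ℝ) (x y : E) : E := H ⟪x, y⟫ • (y - ⟪x, y⟫ • x)

lemma abs_inner_le_one {x y : E} (hx : ‖x‖ ≤ 1) (hy : ‖y‖ ≤ 1) : |⟪x, y⟫| ≤ 1 := by
  have := abs_real_inner_le_norm x y
  have := norm_nonneg x
  have := norm_nonneg y
  nlinarith

lemma norm_sub_inner_smul_le {x y : E} (hx : ‖x‖ ≤ 1) (hy : ‖y‖ ≤ 1) :
    ‖y - ⟪x, y⟫ • x‖ ≤ 2 := by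
  have h := abs_inner_le_one hx hy
  calc _ ≤ ‖y‖ + |⟪x, y⟫| * ‖x‖ := by
        rw [← Real.norm_eq_abs, ← norm_smul]; exact norm_sub_le _ _
    _ ≤ 1 + 1 * 1 := by gcongr
    _ = 2 := by norm_num

variable {H : ℝ → ℝ} {B L : ℝ}

lemma norm_attraction_le (hB : ∀ u, |H u| ≤ B) {x y : E} (hx : ‖x‖ ≤ 1) (hy : ‖y‖ ≤ 1) :
    ‖attraction H x y‖ ≤ B * 2 := by
  rw [attraction, norm_smul]
  exact mul_le_mul (hB _) (norm_sub_inner_smul_le hx hy) (norm_nonneg _) ((abs_nonneg _).trans (hB 0))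

lemma norm_attraction_sub_le (hL0 : 0 ≤ L) (hB : ∀ u, |H u| ≤ B)
    (hL : ∀ u v, |H u - H v| ≤ L * |u - v|) {x y x' y' : E} (hx : ‖x‖ ≤ 1) (hy : ‖y‖ ≤ 1)
    (hx' : ‖x'‖ ≤ 1) (hy' : ‖y'‖ ≤ 1) :
    ‖attraction H x y - attraction H x' y'‖ ≤ (2 * L + 2 * B) * (‖x - x'‖ + ‖y - y'‖) := by
  have hB0 : 0 ≤ B := (abs_nonneg _).trans (hB 0)
  set u := ⟪x, y⟫ with hu
  set u' := ⟪x', y'⟫ with hu'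
  have hu1 : |u'| ≤ 1 := abs_inner_le_one hx' hy'
  have huu : |u - u'| ≤ ‖x - x'‖ + ‖y - y'‖ := by
    have e : u - u' = ⟪x - x', y⟫ + ⟪x', y - y'⟫ := by
      rw [inner_sub_left, inner_sub_right]; ring
    rw [e]
    calc _ ≤ |⟪x - x', y⟫| + |⟪x', y - y'⟫| := abs_add_le _ _
      _ ≤ ‖x - x'‖ * ‖y‖ + ‖x'‖ * ‖y - y'‖ :=
        add_le_add (abs_real_inner_le_norm _ _) (abs_real_inner_le_norm _ _)
      _ ≤ ‖x - x'‖ * 1 + 1 * ‖y - y'‖ := by gcongr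
      _ = _ := by ring
  have hW : ‖(y - u • x) - (y' - u' • x')‖ ≤ 2 * (‖x - x'‖ + ‖y - y'‖) := by
    have e : (y - u • x) - (y' - u' • x') = (y - y') - (u - u') • x - u' • (x - x') := by
      module
    rw [e]
    calc _ ≤ ‖y - y'‖ + |u - u'| * ‖x‖ + |u'| * ‖x - x'‖ := by
          rw [← Real.norm_eq_abs, ← Real.norm_eq_abs, ← norm_smul, ← norm_smul]
          exact (norm_sub_le _ _).trans (add_le_add_left (norm_sub_le _ _) _)
      _ ≤ ‖y - y'‖ + (‖x - x'‖ + ‖y - y'‖) * 1 + 1 * ‖x - x'‖ := by gcongr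
      _ = _ := by ring
  have e : attraction H x y - attraction H x' y' =
      (H u - H u') • (y - u • x) + H u' • ((y - u • x) - (y' - u' • x')) := by
    simp only [attraction, ← hu, ← hu']
    module
  rw [e]
  calc _ ≤ |H u - H u'| * ‖y - u • x‖ + |H u'| * ‖(y - u • x) - (y' - u' • x')‖ := by
        rw [← Real.norm_eq_abs, ← Real.norm_eq_abs, ← norm_smul, ← norm_smul]
        exact norm_add_le _ _
    _ ≤ L * (‖x - x'‖ + ‖y - y'‖) * 2 + B * (2 * (‖x - x'‖ + ‖y - y'‖)) := by
        gcongr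
        · exact (hL _ _).trans (by gcongr)
        · exact norm_sub_inner_smul_le hx hy
        · exact hB _
    _ = _ := by ring

/-- Inside the ball `z · (y - (z · y) z) = (z · y)(1 - |z|²)`. Outside, `ballProj z` is a unit
vector parallel to `z`, and the attraction at a unit vector is orthogonal to it, so the product
vanishes. Off the sphere, the retracted field thus drives `1 - |z|²` at a rate that is at most
linear in it. -/
lemma abs_inner_attraction_le (hB : ∀ u, |H u| ≤ B) (z : E) {y : E} (hy : ‖y‖ ≤ 1) :
    |⟪z, attraction H (ballProj z) y⟫| ≤ B * |1 - ‖z‖ ^ 2| := by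
  set p := ballProj z with hp
  set u := ⟪p, y⟫ with hu
  have hu1 : |u| ≤ 1 := abs_inner_le_one (norm_ballProj_le z) hy
  have hz : z = (max 1 ‖z‖) • p := by
    rw [hp, ballProj, smul_inv_smul₀ (by positivity)]
  have e : ⟪z, attraction H p y⟫ = H u * (max 1 ‖z‖ * (u * (1 - ‖p‖ ^ 2))) := by
    conv_lhs => rw [hz]
    rw [attraction, ← hu, inner_smul_left, inner_smul_right, inner_sub_right, inner_smul_right,
      real_inner_self_eq_norm_sq, ← hu]
    simp
    ring
  have hB0 : 0 ≤ B := (abs_nonneg _).trans (hB 0)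
  rw [e]
  rcases le_total ‖z‖ 1 with h | h
  · rw [hp, ballProj_of_norm_le h, max_eq_left h, one_mul, abs_mul, abs_mul]
    have := mul_le_mul_of_nonneg_right hu1 (abs_nonneg (1 - ‖z‖ ^ 2))
    rw [one_mul] at this
    exact mul_le_mul (hB _) this (by positivity) hB0
  · have : ‖p‖ = 1 := by
      rw [hp, ballProj, max_eq_right h, norm_smul, norm_inv, norm_norm, inv_mul_cancel₀ (by positivity)]
    rw [this]
    simp only [one_pow, sub_self, mul_zero, abs_zero]
    positivity

/-- Since `z · y ≤ 1` and `n · z ≥ 0`, one has `n · y - (z · y)(n · z) ≥ n · y - n · z ≥ 0`: a point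
is never pulled down by one that is at least as high. -/
lemma inner_attraction_nonneg (hH : ∀ u, 0 ≤ H u) {z y n : E} (hz : ‖z‖ ≤ 1) (hy : ‖y‖ ≤ 1)
    (h0 : 0 ≤ ⟪n, z⟫) (h : ⟪n, z⟫ ≤ ⟪n, y⟫) : 0 ≤ ⟪n, attraction H z y⟫ := by
  have hu := (abs_le.1 (abs_inner_le_one hz hy)).2
  rw [attraction, inner_smul_right, inner_sub_right, inner_smul_right]
  refine mul_nonneg (hH _) ?_
  nlinarith

end Field

/-! ### Invariance of the sphere and of the cap -/

section Invariance

variable {E : Type*} [NormedAddCommGroup E] [InnerProductSpace ℝ E]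

/-- Grönwall for `1 - |z|²`, which starts at zero. -/
lemma norm_eq_one_of_abs_inner_le {z z' : ℝ → E} {B : ℝ}
    (hz : ∀ t, 0 ≤ t → HasDerivWithinAt z (z' t) (Ici 0) t) (h0 : ‖z 0‖ = 1)
    (hb : ∀ t, 0 ≤ t → |⟪z t, z' t⟫| ≤ B * |1 - ‖z t‖ ^ 2|) {t : ℝ} (ht : 0 ≤ t) : ‖z t‖ = 1 := by
  have hd : ∀ s, 0 ≤ s → HasDerivWithinAt (fun s => 1 - ‖z s‖ ^ 2) (-(2 * ⟪z s, z' s⟫)) (Ici 0) s :=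
    fun s hs => ((hz s hs).norm_sq).const_sub 1
  have := norm_le_gronwallBound_of_norm_deriv_right_le (a := 0) (b := t) (δ := 0) (K := 2 * B)
    (ε := 0) (fun s hs => (hd s hs.1).continuousWithinAt.mono Icc_subset_Ici_self)
    (fun s hs => (hd s hs.1).mono (Ici_subset_Ici.2 hs.1)) (by simp [h0])
    (fun s hs => by
      have := hb s hs.1
      simp only [norm_neg, norm_mul, Real.norm_eq_abs, abs_two]
      linarith) t (right_mem_Icc.2 ht)
  rw [gronwallBound_ε0_δ0, norm_le_zero_iff, sub_eq_zero] at this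
  exact (pow_eq_one_iff_of_nonneg (norm_nonneg _) two_ne_zero).1 this.symm

lemma le_of_deriv_nonneg_of_mem_Ioo {f f' : ℝ → ℝ} {a : ℝ} (ha : 0 < a)
    (hf : ∀ t, 0 ≤ t → HasDerivWithinAt f (f' t) (Ici 0) t) (h0 : a ≤ f 0)
    (h : ∀ t, 0 ≤ t → f t ∈ Ioo 0 a → 0 ≤ f' t) {t : ℝ} (ht : 0 ≤ t) : a ≤ f t := by
  by_contra! hlt
  set δ := min (a / 2) ((a - f t) / 2) / (1 + t) with hδ
  have hm : 0 < min (a / 2) ((a - f t) / 2) := lt_min (by linarith) (by linarith)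
  -- The barrier `a - f ≤ δ (1 + s)` has a strictly positive slope. The first term of the minimum
  -- puts `f` in `(0, a)` at a contact, where `f' ≥ 0` excludes a crossing; the second makes the
  -- bound at time `t` contradict `f t < a`.
  have hδ0 : 0 < δ := by positivity
  have hδt : δ * (1 + t) = min (a / 2) ((a - f t) / 2) := by
    rw [hδ]; field_simp
  have hd : ∀ s, 0 ≤ s → HasDerivWithinAt (fun s => a - f s) (-f' s) (Ici 0) s :=
    fun s hs => (hf s hs).const_sub a
  have key := image_le_of_deriv_right_lt_deriv_boundary (a := 0) (b := t)
    (B := fun s => δ * (1 + s)) (B' := fun _ => δ)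
    (fun s hs => (hd s hs.1).continuousWithinAt.mono Icc_subset_Ici_self)
    (fun s hs => (hd s hs.1).mono (Ici_subset_Ici.2 hs.1))
    (by simp only [add_zero, mul_one]; linarith)
    (fun s => by simpa using ((hasDerivAt_id s).const_add 1).const_mul δ)
    (fun s hs hs' => by
      have h1 : δ * (1 + s) ≤ δ * (1 + t) := by have := hs.2; gcongr
      have h2 : 0 < δ * (1 + s) := by have := hs.1; positivity
      have h3 := min_le_left (a / 2) ((a - f t) / 2)
      have := h s hs.1 ⟨by linarith, by linarith⟩
      linarith) (right_mem_Icc.2 ht)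
  have h3 := min_le_right (a / 2) ((a - f t) / 2)
  simp only [hδt] at key
  linarith

end Invariance

/-! ### Global flow of the particle system -/

section Flow

variable {E : Type*} [NormedAddCommGroup E] [InnerProductSpace ℝ E]

lemma norm_integral_sub_integral_le {Y : Type*} [MeasurableSpace Y] {μ : Measure Y}
    [IsProbabilityMeasure μ] {f g : Y → E} {C : ℝ} (hf : Integrable f μ) (hg : Integrable g μ)
    (h : ∀ y, ‖f y - g y‖ ≤ C) : ‖∫ y, f y ∂μ - ∫ y, g y ∂μ‖ ≤ C := by
  rw [← integral_sub hf hg]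
  simpa using norm_integral_le_of_norm_le_const (μ := μ) (Filter.Eventually.of_forall h)

variable [CompleteSpace E] [SecondCountableTopology E]
variable {Y : Type*} [TopologicalSpace Y] [CompactSpace Y] [MeasurableSpace Y]
  [OpensMeasurableSpace Y] {μ : Measure Y} [IsProbabilityMeasure μ] {H : ℝ → ℝ} {B L : ℝ}

/-- Global existence for the interacting particle system indexed by a compact probability space,
starting on the unit sphere inside a cap around `n`: it stays on the sphere and inside the cap. -/
lemma exists_flow (hL0 : 0 ≤ L) (hH : ∀ u, 0 ≤ H u) (hB : ∀ u, |H u| ≤ B)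
    (hL : ∀ u v, |H u - H v| ≤ L * |u - v|) {n : E} (hn : ‖n‖ = 1) {a : ℝ} (ha : 0 < a)
    (ha1 : a ≤ 1) (ψ₀ : C(Y, E)) (h1 : ∀ y, ‖ψ₀ y‖ = 1) (hcap : ∀ y, a ≤ ⟪n, ψ₀ y⟫) :
    ∃ Ψ : ℝ → C(Y, E), Ψ 0 = ψ₀ ∧ ∀ t, 0 ≤ t → ∀ x, ‖Ψ t x‖ = 1 ∧ a ≤ ⟪n, Ψ t x⟫ ∧
      HasDerivWithinAt (fun s => Ψ s x) (∫ y, attraction H (Ψ t x) (Ψ t y) ∂μ) (Ici 0) t := by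
  have hB0 : 0 ≤ B := (abs_nonneg _).trans (hB 0)
  -- The cap of the sphere is not convex, but ball intersected with half-space is; the sphere is
  -- recovered afterwards.
  set C : Set E := Metric.closedBall 0 1 ∩ {z | a ≤ ⟪n, z⟫} with hC
  have hCc : IsClosed C := Metric.isClosed_closedBall.inter
    (isClosed_le continuous_const (continuous_const.inner continuous_id))
  have hCconv : Convex ℝ C := (convex_closedBall 0 1).inter
    (convex_halfSpace_ge (innerSL ℝ n).toLinearMap.isLinear a)
  have hCn : n ∈ C := ⟨by simp [hn], by simp [hn, ha1]⟩
  obtain ⟨P, hPC, hPid, hPlip⟩ := exists_lipschitz_projection ⟨n, hCn⟩ hCc.isComplete hCconv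
  have hP1 : ∀ x, ‖P x‖ ≤ 1 := fun x => by simpa using (hPC x).1
  have hPcont : Continuous P :=
    (LipschitzWith.of_dist_le_mul (K := 1) fun x y => by
      simpa [dist_eq_norm] using hPlip x y).continuous
  -- The two arguments are retracted differently. The moving point uses `ballProj`, which preserves
  -- its direction, as the norm estimate requires. The source uses `P`, so that all sources have
  -- height at least `a` before the cap is known to be invariant.
  have hGlip : ∀ x y x' y' : E,
      ‖attraction H (ballProj x) (P y) - attraction H (ballProj x') (P y')‖ ≤
        (2 * L + 2 * B) * (2 * ‖x - x'‖ + ‖y - y'‖) := fun x y x' y' => by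
    refine (norm_attraction_sub_le hL0 hB hL (norm_ballProj_le x) (hP1 y) (norm_ballProj_le x')
      (hP1 y')).trans ?_
    gcongr
    · exact norm_ballProj_sub_le x x'
    · exact hPlip y y'
  have hGcont : ∀ x : E, Continuous fun y => attraction H (ballProj x) (P y) := fun x =>
    (LipschitzWith.of_dist_le_mul (K := (2 * L + 2 * B).toNNReal) fun y y' => by
      rw [dist_eq_norm, dist_eq_norm, Real.coe_toNNReal _ (by positivity)]
      simpa using hGlip x y x y').continuous
  have hint : ∀ (x : E) (ψ : C(Y, E)),
      Integrable (fun y => attraction H (ballProj x) (P (ψ y))) μ := fun x ψ =>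
    Integrable.of_bound ((hGcont x).comp ψ.continuous).aestronglyMeasurable (B * 2)
      (Filter.Eventually.of_forall fun y => norm_attraction_le hB (norm_ballProj_le x) (hP1 _))
  have hVlip : ∀ (x x' : E) (ψ ψ' : C(Y, E)),
      ‖∫ y, attraction H (ballProj x) (P (ψ y)) ∂μ - ∫ y, attraction H (ballProj x') (P (ψ' y)) ∂μ‖
        ≤ (2 * L + 2 * B) * (2 * ‖x - x'‖ + ‖ψ - ψ'‖) := fun x x' ψ ψ' => by
    refine norm_integral_sub_integral_le (hint x ψ) (hint x' ψ') fun y => (hGlip _ _ _ _).trans ?_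
    gcongr
    exact (ψ - ψ').norm_coe_le_norm y
  let V : C(Y, E) → C(Y, E) := fun ψ =>
    ⟨fun x => ∫ y, attraction H (ballProj (ψ x)) (P (ψ y)) ∂μ, by
      have : Continuous fun x : E => ∫ y, attraction H (ballProj x) (P (ψ y)) ∂μ :=
        (LipschitzWith.of_dist_le_mul (K := ((2 * L + 2 * B) * 2).toNNReal) fun x x' => by
          rw [dist_eq_norm, dist_eq_norm, Real.coe_toNNReal _ (by positivity)]
          simpa [mul_assoc] using hVlip x x' ψ ψ).continuous
      exact this.comp ψ.continuous⟩
  have hV : LipschitzWith ((2 * L + 2 * B) * 3).toNNReal V :=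
    LipschitzWith.of_dist_le_mul fun ψ ψ' => by
      rw [dist_eq_norm, dist_eq_norm, Real.coe_toNNReal _ (by positivity),
        ContinuousMap.norm_le _ (by positivity)]
      intro x
      refine (hVlip (ψ x) (ψ' x) ψ ψ').trans ?_
      have : ‖ψ x - ψ' x‖ ≤ ‖ψ - ψ'‖ := (ψ - ψ').norm_coe_le_norm x
      calc _ ≤ (2 * L + 2 * B) * (2 * ‖ψ - ψ'‖ + ‖ψ - ψ'‖) := by gcongr
        _ = _ := by ring
  have hVB : ∀ ψ, ‖V ψ‖ ≤ B * 2 := fun ψ => by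
    rw [ContinuousMap.norm_le _ (by positivity)]
    intro x
    change ‖∫ y, attraction H (ballProj (ψ x)) (P (ψ y)) ∂μ‖ ≤ B * 2
    simpa using norm_integral_le_of_norm_le_const (μ := μ) (Filter.Eventually.of_forall
      fun y => norm_attraction_le hB (norm_ballProj_le (ψ x)) (hP1 (ψ y)))
  obtain ⟨Ψ, hΨ0, hΨ⟩ := exists_global_solution hV hVB ψ₀
  have hd : ∀ x t, 0 ≤ t → HasDerivWithinAt (fun s => Ψ s x)
      (∫ y, attraction H (ballProj (Ψ t x)) (P (Ψ t y)) ∂μ) (Ici 0) t := fun x t ht =>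
    (ContinuousMap.evalCLM ℝ x : C(Y, E) →L[ℝ] E).hasFDerivAt.comp_hasDerivWithinAt t (hΨ t ht)
  have hone : ∀ x t, 0 ≤ t → ‖Ψ t x‖ = 1 := fun x t ht => by
    refine norm_eq_one_of_abs_inner_le (B := B) (hd x) (by rw [hΨ0, h1]) (fun s _ => ?_) ht
    rw [← integral_inner (hint _ _)]
    simpa using norm_integral_le_of_norm_le_const (μ := μ)
      (f := fun y => ⟪Ψ s x, attraction H (ballProj (Ψ s x)) (P (Ψ s y))⟫)
      (Filter.Eventually.of_forall
      fun y => abs_inner_attraction_le hB (Ψ s x) (hP1 (Ψ s y)))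
  have hcapt : ∀ x t, 0 ≤ t → a ≤ ⟪n, Ψ t x⟫ := fun x t ht => by
    refine le_of_deriv_nonneg_of_mem_Ioo ha (f := fun s => ⟪n, Ψ s x⟫)
      (fun s hs => (innerSL ℝ n).hasFDerivAt.comp_hasDerivWithinAt s (hd x s hs))
      (by rw [hΨ0]; exact hcap x) (fun s hs hmem => ?_) ht
    change 0 ≤ ⟪n, ∫ y, attraction H (ballProj (Ψ s x)) (P (Ψ s y)) ∂μ⟫
    rw [← integral_inner (hint _ _), ballProj_of_norm_le (hone x s hs).le]
    exact integral_nonneg fun y => inner_attraction_nonneg hH (hone x s hs).le (hP1 _) hmem.1.le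
      (hmem.2.le.trans (hPC _).2)
  refine ⟨Ψ, hΨ0, fun t ht x => ⟨hone x t ht, hcapt x t ht, ?_⟩⟩
  -- On the sphere and in the cap both retractions are the identity.
  have e : ∀ y, attraction H (ballProj (Ψ t x)) (P (Ψ t y)) = attraction H (Ψ t x) (Ψ t y) :=
    fun y => by
      rw [ballProj_of_norm_le (hone x t ht).le, hPid _ ⟨by simp [hone y t ht], hcapt y t ht⟩]
  simpa only [e] using hd x t ht

end Flow

/-! ### Back to the disk: velocity, supports and uniqueness -/

variable {k : ℕ} {ε : ℝ}

/-- By the triangle inequality through the North pole, two points of the disk are at distance less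
than `π - 2ε`, which keeps them uniformly away from antipodal pairs. -/
lemma neg_cos_lt_inner (hε : ε ∈ Ioo 0 (Real.pi / 2)) (x y : openDisk k ε) :
    -Real.cos (2 * ε) < ⟪((x : Sph k) : Ambient k), ((y : Sph k) : Ambient k)⟫ := by
  have hangle : ∀ a b : Sph k,
      InnerProductGeometry.angle (a : Ambient k) (b : Ambient k) = geoDist a b := fun a b => by
    simp [InnerProductGeometry.angle, geoDist]
  have h1 := InnerProductGeometry.angle_le_angle_add_angle ((x : Sph k) : Ambient k)
    (northPole k : Ambient k) ((y : Sph k) : Ambient k)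
  rw [InnerProductGeometry.angle_comm (northPole k : Ambient k), hangle, hangle, hangle] at h1
  have hx : geoDist (x : Sph k) (northPole k) < Real.pi / 2 - ε := x.2
  have hy : geoDist (y : Sph k) (northPole k) < Real.pi / 2 - ε := y.2
  have h2 : geoDist (x : Sph k) (y : Sph k) < Real.pi - 2 * ε := by linarith
  have h3 := Real.cos_lt_cos_of_nonneg_of_le_pi (Real.arccos_nonneg _) (by linarith [hε.1]) h2
  rw [Real.cos_pi_sub] at h3
  rw [Real.cos_arccos (by
    have := (abs_le.1 (abs_inner_le_one (x := ((x : Sph k) : Ambient k))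
      (y := ((y : Sph k) : Ambient k)) (by simp) (by simp))).1
    exact this) (inner_le_one _ _)] at h3
  exact h3

lemma exists_attraction_eq {K : Sph k → Sph k → ℝ} {g : ℝ → ℝ} (hε : ε ∈ Ioo 0 (Real.pi / 2))
    (hK : HypothesisH K g) (hg : ∀ s : ℝ, 0 ≤ s → 0 ≤ derivWithin g (Ici 0) s) :
    ∃ (H : ℝ → ℝ) (B L : ℝ), 0 ≤ L ∧ (∀ u, 0 ≤ H u) ∧ (∀ u, |H u| ≤ B) ∧
      (∀ u v, |H u - H v| ≤ L * |u - v|) ∧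
      ∀ (ρ : ℝ≥0 → ProbabilityMeasure (openDisk k ε)) (x : openDisk k ε) (t : ℝ≥0),
        velocity K ρ x t =
          ∫ y : openDisk k ε, attraction H ((x : Sph k) : Ambient k) ((y : Sph k) : Ambient k)
            ∂(ρ t : Measure (openDisk k ε)) := by
  have hc : -1 < -Real.cos (2 * ε) := by
    have := Real.cos_lt_cos_of_nonneg_of_le_pi le_rfl (by linarith [hε.2] : 2 * ε ≤ Real.pi)
      (by linarith [hε.1] : 0 < 2 * ε)
    rw [Real.cos_zero] at this
    linarith
  obtain ⟨H, B, L, -, hL0, hH, hB, hL, heq⟩ :=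
    exists_coeff hK hg hc (by linarith [Real.neg_one_le_cos (2 * ε)])
  refine ⟨H, B, L, hL0, hH, hB, hL, fun ρ x t => ?_⟩
  rw [velocity, ← integral_neg]
  congr 1
  ext1 y
  have h := neg_cos_lt_inner hε x y
  rw [sphGradient_eq hK (hc.trans h), neg_neg, attraction, heq _ ⟨h.le, inner_le_one _ _⟩]

lemma geoDist_northPole_le_iff {r : ℝ} (h0 : 0 ≤ r) (h1 : r ≤ Real.pi) (x : Sph k) :
    geoDist x (northPole k) ≤ r ↔ Real.cos r ≤ ⟪(northPole k : Ambient k), (x : Ambient k)⟫ := by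
  have hu : -1 ≤ ⟪(x : Ambient k), (northPole k : Ambient k)⟫ :=
    (abs_le.1 (abs_inner_le_one (x := (x : Ambient k)) (y := (northPole k : Ambient k))
      (by simp) (by simp))).1
  rw [real_inner_comm, geoDist]
  constructor
  · intro h
    rw [← Real.cos_arccos hu (inner_le_one _ _)]
    exact Real.cos_le_cos_of_nonneg_of_le_pi (Real.arccos_nonneg _) h1 h
  · intro h
    rw [← Real.arccos_cos h0 h1]
    exact Real.antitone_arccos h

lemma isClosed_closedDisk (k : ℕ) (r : ℝ) : IsClosed (closedDisk k r) := by
  refine isClosed_le (Real.continuous_arccos.comp ?_) continuous_const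
  exact continuous_subtype_val.inner continuous_const

/-- A flow map is determined by its velocity fields, up to perturbations that are controlled by the
distance between the flow maps. -/
lemma eq_of_isGlobalFlowMap {X X' : openDisk k ε → ℝ≥0 → Ambient k} {S : Set (openDisk k ε)}
    {Φ Ψ : S → ℝ≥0 → openDisk k ε} (hΦ : IsGlobalFlowMap X S Φ) (hΨ : IsGlobalFlowMap X' S Ψ)
    {Λ : ℝ} (hΛ : 0 < Λ)
    (h : ∀ (t : ℝ≥0) (δ : ℝ),
      (∀ s, ‖((Φ s t : Sph k) : Ambient k) - ((Ψ s t : Sph k) : Ambient k)‖ ≤ δ) →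
      ∀ s, ‖X (Φ s t) t - X' (Ψ s t) t‖ ≤ Λ * δ) : Φ = Ψ := by
  funext s t
  -- The a priori bound `2` holds because both flows stay on the unit sphere.
  have key := eq_of_deriv_sub_le (ι := S) (M := 2)
    (u := fun s t => ((Φ s t.toNNReal : Sph k) : Ambient k))
    (v := fun s t => ((Ψ s t.toNNReal : Sph k) : Ambient k))
    (u' := fun s t => X (Φ s t.toNNReal) t.toNNReal)
    (v' := fun s t => X' (Ψ s t.toNNReal) t.toNNReal) hΛ
    (fun s t ht => by
      have := (hΦ s).2 t.toNNReal
      rwa [Real.coe_toNNReal _ ht] at this)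
    (fun s t ht => by
      have := (hΨ s).2 t.toNNReal
      rwa [Real.coe_toNNReal _ ht] at this)
    (fun s => by simp [(hΦ s).1, (hΨ s).1])
    (fun s t _ => (norm_sub_le _ _).trans (by simp; norm_num))
    (fun t _ δ hδ s => h _ δ hδ s) s t t.2
  simp only [Real.toNNReal_coe] at key
  exact Subtype.ext (Subtype.ext key)

/-- The domain of the flow map depends on `ρ 0`; this replaces it by `ρ₀` inside the types. -/
lemma isGlobalWeakSolution_iff {K : Sph k → Sph k → ℝ}
    {ρ : ℝ≥0 → ProbabilityMeasure (openDisk k ε)} {ρ₀ : ProbabilityMeasure (openDisk k ε)}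
    (h : ρ 0 = ρ₀) : IsGlobalWeakSolution K ρ ↔
      ∃ Ψ : (ρ₀ : Measure (openDisk k ε)).support → ℝ≥0 → openDisk k ε,
        IsGlobalFlowMap (velocity K ρ) _ Ψ ∧
        (∀ Φ : (ρ₀ : Measure (openDisk k ε)).support → ℝ≥0 → openDisk k ε,
          IsGlobalFlowMap (velocity K ρ) _ Φ → Φ = Ψ) ∧
        ∀ t : ℝ≥0, (ρ t : Measure (openDisk k ε)) =
          pushforward (fun x => Ψ x t) (ρ₀ : Measure (openDisk k ε)) := by
  subst h
  rfl

section Support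

variable {Ω : Type*} [MeasurableSpace Ω] {S : Set Ω} {μ : Measure Ω}

lemma isProbabilityMeasure_comap_coe [IsProbabilityMeasure μ] (hS : MeasurableSet S)
    (hμ : μ Sᶜ = 0) : IsProbabilityMeasure (μ.comap ((↑) : S → Ω)) := by
  constructor
  rw [(MeasurableEmbedding.subtype_coe hS).comap_apply, image_univ, Subtype.range_coe]
  exact (prob_compl_eq_zero_iff hS).1 hμ

lemma pushforward_coe (hS : MeasurableSet S) (hμ : μ Sᶜ = 0) :
    pushforward ((↑) : S → Ω) μ = μ := by
  rw [pushforward, map_comap_subtype_coe hS]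
  exact Measure.restrict_eq_self_of_ae_mem (mem_ae_iff.2 hμ)

/-- Measurability is not part of the notion of weak solution. It comes for free: `Measure.map` of a
map that is not a.e. measurable is zero, whereas `ρ_t` has mass one. -/
lemma aemeasurable_of_pushforward_ne_zero {Ψ : S → Ω} (h : pushforward Ψ μ ≠ 0) :
    AEMeasurable Ψ (μ.comap ((↑) : S → Ω)) := by
  by_contra hn
  exact h (Measure.map_of_not_aemeasurable hn)

end Support

section Velocity

variable {H : ℝ → ℝ} {B L : ℝ}

lemma continuous_attraction {E : Type*} [NormedAddCommGroup E] [InnerProductSpace ℝ E]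
    (hL : ∀ u v, |H u - H v| ≤ L * |u - v|) (x : E) : Continuous fun y => attraction H x y := by
  have hH : Continuous H := (LipschitzWith.of_dist_le_mul (K := L.toNNReal) fun u v => by
    rw [Real.dist_eq, Real.dist_eq]
    exact (hL u v).trans (by gcongr; exact Real.le_coe_toNNReal L)).continuous
  have h : Continuous fun y : E => ⟪x, y⟫ := continuous_const.inner continuous_id
  exact (hH.comp h).smul (continuous_id.sub (h.smul continuous_const))

lemma continuous_coe_coe : Continuous fun y : openDisk k ε => ((y : Sph k) : Ambient k) :=
  continuous_subtype_val.comp continuous_subtype_val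

lemma integrable_attraction (hB : ∀ u, |H u| ≤ B) (hL : ∀ u v, |H u - H v| ≤ L * |u - v|)
    {Y : Type*} [MeasurableSpace Y] {ν : Measure Y} [IsFiniteMeasure ν] {φ : Y → openDisk k ε}
    (hφ : AEMeasurable φ ν) (x : openDisk k ε) :
    Integrable (fun y => attraction H ((x : Sph k) : Ambient k) ((φ y : Sph k) : Ambient k)) ν :=
  Integrable.of_bound ((((continuous_attraction hL _).comp
    continuous_coe_coe).measurable.comp_aemeasurable hφ).aestronglyMeasurable) (B * 2)
    (Filter.Eventually.of_forall fun y => norm_attraction_le hB (by simp) (by simp))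

lemma integral_attraction_map (hL : ∀ u v, |H u - H v| ≤ L * |u - v|)
    {Y : Type*} [MeasurableSpace Y] {ν : Measure Y} {φ : Y → openDisk k ε}
    (hφ : AEMeasurable φ ν) (x : openDisk k ε) :
    ∫ y : openDisk k ε, attraction H ((x : Sph k) : Ambient k) ((y : Sph k) : Ambient k) ∂(ν.map φ) =
      ∫ y, attraction H ((x : Sph k) : Ambient k) ((φ y : Sph k) : Ambient k) ∂ν :=
  integral_map hφ ((continuous_attraction hL _).comp continuous_coe_coe).aestronglyMeasurable

/-- Flow maps of the velocity field of a given curve of measures are unique. -/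
lemma isGlobalFlowMap_velocity_unique {K : Sph k → Sph k → ℝ} (hL0 : 0 ≤ L) (hB : ∀ u, |H u| ≤ B)
    (hL : ∀ u v, |H u - H v| ≤ L * |u - v|) {ρ : ℝ≥0 → ProbabilityMeasure (openDisk k ε)}
    (hv : ∀ (x : openDisk k ε) (t : ℝ≥0), velocity K ρ x t =
      ∫ y : openDisk k ε, attraction H ((x : Sph k) : Ambient k) ((y : Sph k) : Ambient k)
        ∂(ρ t : Measure (openDisk k ε)))
    {S : Set (openDisk k ε)} {Φ Ψ : S → ℝ≥0 → openDisk k ε}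
    (hΦ : IsGlobalFlowMap (velocity K ρ) S Φ) (hΨ : IsGlobalFlowMap (velocity K ρ) S Ψ) :
    Φ = Ψ := by
  have hB0 : 0 ≤ B := (abs_nonneg _).trans (hB 0)
  refine eq_of_isGlobalFlowMap hΦ hΨ (Λ := 2 * L + 2 * B + 1) (by positivity) fun t δ hδ s => ?_
  rw [hv, hv]
  refine norm_integral_sub_integral_le (integrable_attraction hB hL aemeasurable_id _)
    (integrable_attraction hB hL aemeasurable_id _) fun y => ?_
  refine (norm_attraction_sub_le hL0 hB hL (by simp) (by simp) (by simp) (by simp)).trans ?_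
  rw [sub_self, norm_zero, add_zero]
  have hδ0 := (norm_nonneg _).trans (hδ s)
  exact mul_le_mul (by linarith) (hδ s) (norm_nonneg _) (by positivity)

/-- Flow maps that transport the same initial measure along their own velocity fields coincide. -/
lemma isGlobalFlowMap_pushforward_unique {K : Sph k → Sph k → ℝ} (hL0 : 0 ≤ L)
    (hB : ∀ u, |H u| ≤ B) (hL : ∀ u v, |H u - H v| ≤ L * |u - v|)
    (hv : ∀ (ρ : ℝ≥0 → ProbabilityMeasure (openDisk k ε)) (x : openDisk k ε) (t : ℝ≥0),
      velocity K ρ x t =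
        ∫ y : openDisk k ε, attraction H ((x : Sph k) : Ambient k) ((y : Sph k) : Ambient k)
          ∂(ρ t : Measure (openDisk k ε)))
    {μ : Measure (openDisk k ε)} {S : Set (openDisk k ε)}
    [IsProbabilityMeasure (μ.comap ((↑) : S → openDisk k ε))]
    {ρ σ : ℝ≥0 → ProbabilityMeasure (openDisk k ε)} {Φ Ψ : S → ℝ≥0 → openDisk k ε}
    (hΦ : IsGlobalFlowMap (velocity K ρ) S Φ) (hΨ : IsGlobalFlowMap (velocity K σ) S Ψ)
    (hρ : ∀ t, (ρ t : Measure (openDisk k ε)) = pushforward (fun x => Φ x t) μ)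
    (hσ : ∀ t, (σ t : Measure (openDisk k ε)) = pushforward (fun x => Ψ x t) μ) :
    Φ = Ψ := by
  have hB0 : 0 ≤ B := (abs_nonneg _).trans (hB 0)
  have hΦm : ∀ t, AEMeasurable (fun x => Φ x t) (μ.comap ((↑) : S → openDisk k ε)) := fun t =>
    aemeasurable_of_pushforward_ne_zero (hρ t ▸ IsProbabilityMeasure.ne_zero _)
  have hΨm : ∀ t, AEMeasurable (fun x => Ψ x t) (μ.comap ((↑) : S → openDisk k ε)) := fun t =>
    aemeasurable_of_pushforward_ne_zero (hσ t ▸ IsProbabilityMeasure.ne_zero _)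
  -- The factor `2` counts the displacement of the particle itself and that of the sources; the `+
  -- 1` only ensures positivity.
  refine eq_of_isGlobalFlowMap hΦ hΨ (Λ := 2 * (2 * L + 2 * B) + 1) (by positivity)
    fun t δ hδ s => ?_
  rw [hv, hv, hρ, hσ, pushforward, pushforward, integral_attraction_map hL (hΦm t),
    integral_attraction_map hL (hΨm t)]
  refine norm_integral_sub_integral_le (integrable_attraction hB hL (hΦm t) _)
    (integrable_attraction hB hL (hΨm t) _) fun y => ?_
  refine (norm_attraction_sub_le hL0 hB hL (by simp) (by simp) (by simp) (by simp)).trans ?_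
  have hδ0 := (norm_nonneg _).trans (hδ s)
  calc _ ≤ (2 * L + 2 * B) * (δ + δ) := by
        gcongr
        · exact hδ s
        · exact hδ y
    _ ≤ _ := by nlinarith

end Velocity

/-! ### Existence on the disk and narrow continuity -/

/-- The open disk is not compact, but as `r < π/2 - ε` it contains the whole compact disk of radius
`r`. -/
lemma isCompact_support_of_subset_closedDisk {μ : Measure (openDisk k ε)} {r : ℝ}
    (hr : r < Real.pi / 2 - ε) (h : ∀ x ∈ μ.support, (x : Sph k) ∈ closedDisk k r) :
    IsCompact μ.support := by
  have hc : IsCompact (((↑) : openDisk k ε → Sph k) ⁻¹' closedDisk k r) := by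
    refine (Topology.IsInducing.subtypeVal.isCompact_preimage_iff ?_).2
      (isClosed_closedDisk k r).isCompact
    intro x hx
    rw [Subtype.range_coe]
    exact lt_of_le_of_lt hx hr
  exact hc.of_isClosed_subset Measure.isClosed_support h

/-- The weak solution carried by the flow of a measure that is supported in a smaller disk. -/
lemma exists_flow_on_disk {H : ℝ → ℝ} {B L : ℝ} (hε : ε ∈ Ioo 0 (Real.pi / 2)) (hL0 : 0 ≤ L)
    (hH : ∀ u, 0 ≤ H u) (hB : ∀ u, |H u| ≤ B) (hL : ∀ u v, |H u - H v| ≤ L * |u - v|) {r : ℝ}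
    (hr : r < Real.pi / 2 - ε) (μ : Measure (openDisk k ε)) [IsProbabilityMeasure μ]
    (hμ : ∀ x ∈ μ.support, (x : Sph k) ∈ closedDisk k r) :
    ∃ Ψ : μ.support → ℝ≥0 → openDisk k ε, (∀ x, Ψ x 0 = x) ∧ (∀ x, Continuous (Ψ x)) ∧
      (∀ t, Continuous fun x => Ψ x t) ∧ (∀ x t, (Ψ x t : Sph k) ∈ closedDisk k r) ∧
      ∀ (x : μ.support) (t : ℝ≥0),
        HasDerivWithinAt (fun s : ℝ => ((Ψ x s.toNNReal : Sph k) : Ambient k))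
          (∫ y, attraction H ((Ψ x t : Sph k) : Ambient k) ((Ψ y t : Sph k) : Ambient k)
            ∂(μ.comap ((↑) : μ.support → openDisk k ε))) (Ici 0) (t : ℝ) := by
  have : CompactSpace μ.support :=
    isCompact_iff_compactSpace.1 (isCompact_support_of_subset_closedDisk hr hμ)
  have : IsProbabilityMeasure (μ.comap ((↑) : μ.support → openDisk k ε)) :=
    isProbabilityMeasure_comap_coe Measure.isClosed_support.measurableSet
      Measure.measure_compl_support
  -- The sign of `r` is not assumed; a point of the support provides `0 ≤ r`.
  obtain ⟨x₀, hx₀⟩ := Measure.nonempty_support (IsProbabilityMeasure.ne_zero μ)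
  have hr0 : 0 ≤ r := (Real.arccos_nonneg _).trans (hμ x₀ hx₀)
  have hrπ : r ≤ Real.pi := by linarith [hε.1, Real.pi_pos]
  -- The cap height is `a = cos r`, positive because `r < π/2`.
  obtain ⟨F, hF0, hF⟩ := exists_flow (μ := μ.comap ((↑) : μ.support → openDisk k ε)) hL0 hH hB hL
    (n := (northPole k : Ambient k)) (by simp)
    (Real.cos_pos_of_mem_Ioo ⟨by linarith [Real.pi_pos], by linarith [hε.1]⟩)
    (Real.cos_le_one r)
    ⟨fun x : μ.support => ((x : openDisk k ε) : Sph k), continuous_coe_coe.comp continuous_subtype_val⟩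
    (fun y => by simp) (fun y => (geoDist_northPole_le_iff hr0 hrπ _).1 (hμ _ y.2))
  have hex : ∀ (x : μ.support) (t : ℝ≥0), ∃ d : openDisk k ε,
      ((d : Sph k) : Ambient k) = F t x ∧ (d : Sph k) ∈ closedDisk k r := fun x t => by
    obtain ⟨h1, h2, -⟩ := hF t t.2 x
    have h3 : geoDist (⟨F t x, by simp [h1]⟩ : Sph k) (northPole k) ≤ r :=
      (geoDist_northPole_le_iff hr0 hrπ _).2 h2
    exact ⟨⟨⟨F t x, by simp [h1]⟩, lt_of_le_of_lt h3 hr⟩, rfl, h3⟩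
  choose Ψ hΨ hΨr using hex
  have hind : Topology.IsInducing fun y : openDisk k ε => ((y : Sph k) : Ambient k) :=
    Topology.IsInducing.subtypeVal.comp Topology.IsInducing.subtypeVal
  have hder : ∀ (x : μ.support) (t : ℝ≥0),
      HasDerivWithinAt (fun s : ℝ => ((Ψ x s.toNNReal : Sph k) : Ambient k))
          (∫ y, attraction H ((Ψ x t : Sph k) : Ambient k) ((Ψ y t : Sph k) : Ambient k)
            ∂(μ.comap ((↑) : μ.support → openDisk k ε))) (Ici 0) (t : ℝ) := fun x t => by
    simp only [hΨ]
    refine (hF t t.2 x).2.2.congr (fun s hs => ?_) ?_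
    · rw [Real.coe_toNNReal _ hs]
    · simp
  refine ⟨Ψ, fun x => ?_, fun x => ?_, fun t => ?_, hΨr, hder⟩
  · apply Subtype.ext
    apply Subtype.ext
    simp [hΨ, hF0]
  · rw [hind.continuous_iff]
    have hco : ContinuousOn (fun s : ℝ => ((Ψ x s.toNNReal : Sph k) : Ambient k)) (Ici 0) :=
      fun s hs => by
        have := (hder x ⟨s, hs⟩).continuousWithinAt
        exact this
    have := hco.comp_continuous NNReal.continuous_coe (fun t => t.2)
    simpa [Function.comp_def] using this
  · rw [hind.continuous_iff]
    refine (F t).continuous.congr fun x => ?_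
    exact (hΨ x t).symm

/-- Dominated convergence against each bounded continuous test function, along each trajectory. -/
lemma continuous_probabilityMeasure_map {S : Type*} [TopologicalSpace S] [MeasurableSpace S]
    [OpensMeasurableSpace S] {ν : Measure S} [IsProbabilityMeasure ν] {Ω : Type*}
    [TopologicalSpace Ω] [MeasurableSpace Ω] [BorelSpace Ω] {T : Type*}
    [TopologicalSpace T] [FirstCountableTopology T] {Ψ : S → T → Ω} (h1 : ∀ x, Continuous (Ψ x))
    (h2 : ∀ t, Continuous fun x => Ψ x t) {ρ : T → ProbabilityMeasure Ω}
    (hρ : ∀ t, (ρ t : Measure Ω) = ν.map fun x => Ψ x t) : Continuous ρ := by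
  rw [continuous_iff_continuousAt]
  intro t₀
  rw [ContinuousAt, ProbabilityMeasure.tendsto_iff_forall_integral_tendsto]
  intro f
  have e : ∀ t, ∫ y, f y ∂(ρ t : Measure Ω) = ∫ x, f (Ψ x t) ∂ν := fun t => by
    rw [hρ, integral_map (h2 t).measurable.aemeasurable
      f.continuous.stronglyMeasurable.aestronglyMeasurable]
  simp only [e]
  refine (continuous_of_dominated (bound := fun _ => ‖f‖) (fun t => ?_) (fun t => ?_)
    (integrable_const _) ?_).tendsto t₀
  · exact (f.continuous.comp (h2 t)).stronglyMeasurable.aestronglyMeasurable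
  · exact Filter.Eventually.of_forall fun x => f.norm_coe_le_norm _
  · exact Filter.Eventually.of_forall fun x => f.continuous.comp (h1 x)

end IntrinsicAggregation

theorem mainTheorem6 (k : ℕ) (hk : 1 ≤ k) (ε : ℝ) (hε : ε ∈ Set.Ioo 0 (Real.pi / 2))
    (K : IntrinsicAggregation.Sph k → IntrinsicAggregation.Sph k → ℝ) (g : ℝ → ℝ)
    (hK : IntrinsicAggregation.HypothesisH K g)
    (hg : ∀ s : ℝ, 0 ≤ s → 0 ≤ derivWithin g (Set.Ici 0) s)
    (r : ℝ) (hr : r < Real.pi / 2 - ε)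
    (ρ₀ : MeasureTheory.ProbabilityMeasure (IntrinsicAggregation.openDisk k ε))
    (hρ₀ : ∀ x ∈ (ρ₀ : MeasureTheory.Measure (IntrinsicAggregation.openDisk k ε)).support,
      (x : IntrinsicAggregation.Sph k) ∈ IntrinsicAggregation.closedDisk k r) :
    ∃ ρ : C(ℝ≥0, MeasureTheory.ProbabilityMeasure (IntrinsicAggregation.openDisk k ε)),
      (IntrinsicAggregation.IsGlobalWeakSolution K ρ ∧ ρ 0 = ρ₀) ∧
      (∀ σ : C(ℝ≥0, MeasureTheory.ProbabilityMeasure (IntrinsicAggregation.openDisk k ε)),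
        IntrinsicAggregation.IsGlobalWeakSolution K σ → σ 0 = ρ₀ → σ = ρ) ∧
      ∀ t : ℝ≥0,
        ∀ x ∈ (ρ t : MeasureTheory.Measure (IntrinsicAggregation.openDisk k ε)).support,
          (x : IntrinsicAggregation.Sph k) ∈ IntrinsicAggregation.closedDisk k r := by
  open IntrinsicAggregation in
  obtain ⟨H, B, L, hL0, hH, hB, hL, hv⟩ := exists_attraction_eq (k := k) hε hK hg
  set μ : Measure (openDisk k ε) := (ρ₀ : Measure (openDisk k ε)) with hμ
  have hS : MeasurableSet μ.support := Measure.isClosed_support.measurableSet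
  have hprob : IsProbabilityMeasure (μ.comap ((↑) : μ.support → openDisk k ε)) :=
    isProbabilityMeasure_comap_coe hS Measure.measure_compl_support
  obtain ⟨Ψ, hΨ0, hΨt, hΨx, hΨr, hΨd⟩ := exists_flow_on_disk hε hL0 hH hB hL hr μ hρ₀
  have hΨm : ∀ t, AEMeasurable (fun x => Ψ x t) (μ.comap ((↑) : μ.support → openDisk k ε)) :=
    fun t => (hΨx t).measurable.aemeasurable
  let ρf : ℝ≥0 → ProbabilityMeasure (openDisk k ε) := fun t =>
    ⟨pushforward (fun x => Ψ x t) μ, Measure.isProbabilityMeasure_map (hΨm t)⟩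
  let ρ : C(ℝ≥0, ProbabilityMeasure (openDisk k ε)) :=
    ⟨ρf, continuous_probabilityMeasure_map hΨt hΨx fun _ => rfl⟩
  have hρ : ∀ t, (ρ t : Measure (openDisk k ε)) = pushforward (fun x => Ψ x t) μ := fun _ => rfl
  have hρ0 : ρ 0 = ρ₀ := by
    apply Subtype.ext
    refine (hρ 0).trans ?_
    simp only [hΨ0]
    exact pushforward_coe hS Measure.measure_compl_support
  have hflow : IsGlobalFlowMap (velocity K ρ) μ.support Ψ := fun x => ⟨hΨ0 x, fun t => by
    rw [hv, hρ, pushforward, integral_attraction_map hL (hΨm t)]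
    exact hΨd x t⟩
  refine ⟨ρ, ⟨(isGlobalWeakSolution_iff hρ0).2 ⟨Ψ, hflow, fun Φ hΦ =>
    isGlobalFlowMap_velocity_unique hL0 hB hL (hv ρ) hΦ hflow, hρ⟩, hρ0⟩, ?_, ?_⟩
  · intro σ hσ hσ0
    obtain ⟨Φ, hΦ, -, hσΦ⟩ := (isGlobalWeakSolution_iff hσ0).1 hσ
    -- Both curves are push-forwards of `ρ₀` along flows on the same set of labels, so equal flows
    -- give equal curves.
    have e : Φ = Ψ := isGlobalFlowMap_pushforward_unique hL0 hB hL hv hΦ hflow hσΦ hρ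
    subst e
    ext1 t
    exact Subtype.ext ((hσΦ t).trans (hρ t).symm)
  · intro t
    have hcl : IsClosed {x : openDisk k ε | (x : Sph k) ∈ closedDisk k r} :=
      (isClosed_closedDisk k r).preimage continuous_subtype_val
    refine Measure.support_subset_of_isClosed hcl ?_
    rw [hρ, pushforward]
    exact (ae_map_iff (hΨm t) hcl.measurableSet).2 (Filter.Eventually.of_forall fun x => hΨr x t)
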